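/- Let $K\ge 1$, let $N_0,N_1,\dots,N_K$ be positive integers and let $q\ge 0$. For $k=1,\dots,K$ let $Q_k$ be a random complex matrix of size $N_k\times N_{k-1}$ with i.i.d. circularly-symmetric complex Gaussian entries of zero mean and unit variance (density $e^{-|z|^2}/\pi$ on $\mathbb{C}$), and let $Q_1,\dots,Q_K$ be independent. Put $H=Q_KQ_{K-1}\cdots Q_1$ (the Rayleigh product channel with dimensions $(N_0,\dots,N_K)$) and define its ergodic capacity by $$\tilde R_q(N_0,N_1,\dots,N_K)=\mathbb{E}\left[\ln\det\left(I+q\,H^{\dagger}H\right)\right],$$ where $H^\dagger$ is the conjugate transpose of $H$. Then this expectation exists and is finite, and it is invariant under permutations of the dimensions: for every permutation $\sigma$ of $\{0,1,\dots,K\}$, $$\tilde R_q(N_{\sigma(0)},N_{\sigma(1)},\dots,N_{\sigma(K)})=\tilde R_q(N_0,N_1,\dots,N_K).$$ -/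

import Mathlib

open MeasureTheory ProbabilityTheory
open scoped Matrix

namespace RayleighProduct

/-- The standard circularly-symmetric complex Gaussian law (zero mean, unit variance): the law of
`x + i y` with `x`, `y` independent real Gaussians of mean `0` and variance `1 / 2`; its density
with respect to Lebesgue measure on `ℂ` is `exp (-|z|²) / π`. -/
noncomputable def complexGaussian : Measure ℂ :=
  ((gaussianReal 0 (1 / 2)).prod (gaussianReal 0 (1 / 2))).map (fun p : ℝ × ℝ => Complex.mk p.1 p.2)

/-- The entries of the component channels `Q₁, …, Q_K` with dimensions `(N₀, …, N_K)`. The index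
`k : Fin K` stands for the channel `Q_{k+1}`, whose matrix `Matrix.of (Q k)` is of size
`N_{k+1} × N_k`. -/
abbrev Channels {K : ℕ} (N : Fin (K + 1) → ℕ) : Type :=
  (k : Fin K) → Fin (N k.succ) → Fin (N k.castSucc) → ℂ

/-- The joint law of the component channels: they are independent, and all their entries are
i.i.d. standard complex Gaussian variables. -/
noncomputable def rayleighLaw {K : ℕ} (N : Fin (K + 1) → ℕ) : Measure (Channels N) :=
  Measure.pi fun k : Fin K => Measure.pi fun _ : Fin (N k.succ) =>
    Measure.pi fun _ : Fin (N k.castSucc) => complexGaussian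

/-- The product channel `H = Q_K * Q_{K-1} * ⋯ * Q₁`, of size `N_K × N₀`. -/
noncomputable def productChannel {K : ℕ} {N : Fin (K + 1) → ℕ} (Q : Channels N) :
    Matrix (Fin (N (Fin.last K))) (Fin (N 0)) ℂ :=
  Fin.induction (motive := fun k => Matrix (Fin (N k)) (Fin (N 0)) ℂ)
    1 (fun k P => Matrix.of (Q k) * P) (Fin.last K)

/-- The capacity `ln det (I + q Hᴴ H)` (nats per channel use) of a realization of the channels.
For `q ≥ 0` the determinant is a positive real number, so it equals its real part. -/
noncomputable def capacity {K : ℕ} {N : Fin (K + 1) → ℕ} (q : ℝ) (Q : Channels N) : ℝ :=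
  Real.log (1 + (q : ℂ) • ((productChannel Q)ᴴ * productChannel Q)).det.re

/-- The ergodic capacity: the expectation of the capacity under the law of the channels. -/
noncomputable def ergodicCapacity {K : ℕ} (N : Fin (K + 1) → ℕ) (q : ℝ) : ℝ :=
  ∫ Q : Channels N, capacity q Q ∂(rayleighLaw N)

end RayleighProduct

/-!
Let `d` be at least all the dimensions and choose `d × Nₖ` matrices `Eₖ` with orthonormal columns.
Since `Eₖᴴ G Eₖ₋₁` has i.i.d. standard Gaussian entries when the `d × d` matrix `G` has, the nonzero
singular values of the channel have the same law as those of `P_K G_K ⋯ P₁ G₁ P₀`, where the `Gₖ`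
are independent Ginibre matrices and `Pₖ = Eₖ Eₖᴴ`. So it suffices that, for a bi-unitarily
invariant function `φ`, the expectation of `φ (P_K G_K ⋯ P₁ G₁ P₀)` is symmetric in `P₀, …, P_K`.

A square matrix and its conjugate transpose differ by unitary factors only, hence
`𝔼 φ (P G Q) = 𝔼 φ (Qᴴ Gᴴ Pᴴ) = 𝔼 φ (Q G P)`: the bi-unitary invariance of Gaussian averages
replaces `Qᴴ` and `Pᴴ` by `Q` and `P`. Conditioning on the remaining Gaussian factors, the same
identity exchanges any two neighbouring `Pₖ`.

The expectation is finite because `log det (1 + A) ≤ tr A` for positive semidefinite `A`, so the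
capacity is at most `q` times the squared Frobenius norm of the product channel.
-/

namespace RayleighProduct

section UnitaryEquivalence

variable {𝕜 m n : Type*} [RCLike 𝕜] [Fintype m]

theorem exists_linearIsometry_of_norm_eq {E V : Type*} [AddCommGroup E] [Module 𝕜 E]
    [NormedAddCommGroup V] [InnerProductSpace 𝕜 V] [FiniteDimensional 𝕜 V] (A B : E →ₗ[𝕜] V)
    (h : ∀ x, ‖A x‖ = ‖B x‖) : ∃ U : V →ₗᵢ[𝕜] V, ∀ x, U (A x) = B x := by
  obtain ⟨s, hs⟩ := A.rangeRestrict.exists_rightInverse_of_surjective A.range_rangeRestrict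
  have hAs (y : LinearMap.range A) : A (s y) = y := congrArg Subtype.val (LinearMap.congr_fun hs y)
  let L : LinearMap.range A →ₗᵢ[𝕜] V :=
    ⟨B ∘ₗ s, fun y => by rw [LinearMap.comp_apply, ← h, hAs, Submodule.coe_norm]⟩
  refine ⟨L.extend, fun x => ?_⟩
  have hker : B (s (A.rangeRestrict x) - x) = 0 := by
    rw [← norm_eq_zero, ← h, map_sub, hAs, LinearMap.codRestrict_apply, sub_self, norm_zero]
  rw [map_sub, sub_eq_zero] at hker
  exact (L.extend_apply (A.rangeRestrict x)).trans hker

theorem inner_toEuclideanLin_self [Fintype n] [DecidableEq n] (A : Matrix m n 𝕜)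
    (x : EuclideanSpace 𝕜 n) :
    inner 𝕜 (Matrix.toEuclideanLin A x) (Matrix.toEuclideanLin A x) =
      inner 𝕜 x (Matrix.toEuclideanLin (Aᴴ * A) x) := by
  classical
  rw [Matrix.toEuclideanLin, Matrix.toLpLin_mul_same, LinearMap.comp_apply,
    ← LinearMap.adjoint_inner_right, ← Matrix.toEuclideanLin_conjTranspose_eq_adjoint]

theorem exists_unitary_mul_eq_of_gram_eq [DecidableEq m] [Finite n] {A B : Matrix m n 𝕜}
    (h : Aᴴ * A = Bᴴ * B) : ∃ U ∈ Matrix.unitaryGroup m 𝕜, U * A = B := by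
  classical
  have := Fintype.ofFinite n
  have hnorm (x : EuclideanSpace 𝕜 n) :
      ‖Matrix.toEuclideanLin A x‖ = ‖Matrix.toEuclideanLin B x‖ := by
    rw [@norm_eq_sqrt_re_inner 𝕜, @norm_eq_sqrt_re_inner 𝕜, inner_toEuclideanLin_self,
      inner_toEuclideanLin_self, h]
  obtain ⟨U, hU⟩ := exists_linearIsometry_of_norm_eq _ _ hnorm
  let W : Matrix m m 𝕜 :=
    (Matrix.toEuclideanCLM (n := m) (𝕜 := 𝕜)).symm U.toContinuousLinearMap
  have hW : Matrix.toEuclideanCLM (𝕜 := 𝕜) W = U.toContinuousLinearMap :=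
    StarAlgEquiv.apply_symm_apply (Matrix.toEuclideanCLM (n := m) (𝕜 := 𝕜)) _
  refine ⟨W, Matrix.mem_unitaryGroup_iff'.2 ?_, Matrix.toEuclideanLin.injective ?_⟩
  · apply EquivLike.injective (Matrix.toEuclideanCLM (n := m) (𝕜 := 𝕜))
    rw [map_mul, map_star, hW, map_one]
    exact U.adjoint_comp_self
  · ext1 x
    rw [Matrix.toEuclideanLin, Matrix.toLpLin_mul_same, ← hU, ← U.coe_toContinuousLinearMap, ← hW]
    rfl

variable [Fintype n] [DecidableEq n]

theorem exists_unitary_conj_eq_of_charpoly_eq {A B : Matrix n n 𝕜} (hA : A.IsHermitian)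
    (hB : B.IsHermitian) (h : A.charpoly = B.charpoly) :
    ∃ U ∈ Matrix.unitaryGroup n 𝕜, U * A * Uᴴ = B := by
  refine ⟨hB.eigenvectorUnitary * star hA.eigenvectorUnitary,
    (hB.eigenvectorUnitary * star hA.eigenvectorUnitary).2, ?_⟩
  have hdiag := hA.conjStarAlgAut_star_eigenvectorUnitary
  rw [(hA.eigenvalues_eq_eigenvalues_iff hB).2 h] at hdiag
  conv_rhs => rw [hB.spectral_theorem, ← hdiag, ← Unitary.conjStarAlgAut_mul_apply]
  rfl

theorem exists_unitary_conjTranspose_eq (M : Matrix n n 𝕜) :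
    ∃ U ∈ Matrix.unitaryGroup n 𝕜, ∃ V ∈ Matrix.unitaryGroup n 𝕜, Mᴴ = U * M * V := by
  obtain ⟨W, hW, hsim⟩ := exists_unitary_conj_eq_of_charpoly_eq
    (Matrix.isHermitian_conjTranspose_mul_self M) (Matrix.isHermitian_mul_conjTranspose_self M)
    (Matrix.charpoly_mul_comm _ _)
  obtain ⟨U, hU, hUM⟩ := exists_unitary_mul_eq_of_gram_eq (A := M * Wᴴ) (B := Mᴴ) <| by
    simpa only [Matrix.conjTranspose_mul, Matrix.conjTranspose_conjTranspose, Matrix.mul_assoc]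
      using hsim
  exact ⟨U, hU, Wᴴ, Unitary.star_mem hW, by rw [← hUM, Matrix.mul_assoc]⟩

end UnitaryEquivalence

section Ginibre

variable {m n m' n' : Type*}

noncomputable instance instMeasurableSpaceMatrix : MeasurableSpace (Matrix m n ℂ) :=
  inferInstanceAs (MeasurableSpace (m → n → ℂ))

instance instBorelSpaceMatrix [Countable m] [Countable n] : BorelSpace (Matrix m n ℂ) :=
  inferInstanceAs (BorelSpace (m → n → ℂ))

instance instSecondCountableTopologyMatrix [Countable m] [Countable n] :
    SecondCountableTopology (Matrix m n ℂ) :=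
  inferInstanceAs (SecondCountableTopology (m → n → ℂ))

variable [Fintype m] [Fintype n] [Fintype m'] [Fintype n']

/-- The squared Frobenius norm of a complex matrix. -/
noncomputable def frobeniusSq (X : Matrix m n ℂ) : ℝ := ∑ i, ∑ j, ‖X i j‖ ^ 2

theorem frobeniusSq_eq_zero {X : Matrix m n ℂ} : frobeniusSq X = 0 ↔ X = 0 := by
  rw [frobeniusSq, Fintype.sum_eq_zero_iff_of_nonneg (fun i => by positivity)]
  simp [funext_iff, ← Matrix.ext_iff, Finset.sum_eq_zero_iff_of_nonneg]

theorem trace_conjTranspose_mul (X T : Matrix m n ℂ) :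
    (Xᴴ * T).trace = ∑ i, ∑ j, star (X i j) * T i j :=
  Finset.sum_comm

theorem trace_conjTranspose_mul_self (X : Matrix m n ℂ) : (Xᴴ * X).trace = frobeniusSq X := by
  rw [trace_conjTranspose_mul, frobeniusSq]
  push_cast
  simp only [Complex.star_def, Complex.conj_mul']

/-- The characteristic function of a measure on complex matrices, with respect to the real inner
product `Re tr (Xᴴ T)`. -/
noncomputable def matrixCharFun (μ : Measure (Matrix m n ℂ)) (T : Matrix m n ℂ) : ℂ :=
  ∫ X, Complex.exp ((Xᴴ * T).trace.re * Complex.I) ∂μ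

theorem measure_ext_of_matrixCharFun {μ ν : Measure (Matrix m n ℂ)} [IsFiniteMeasure μ]
    [IsFiniteMeasure ν] (h : matrixCharFun μ = matrixCharFun ν) : μ = ν := by
  let pairing : Matrix m n ℂ →ₗ[ℝ] Matrix m n ℂ →ₗ[ℝ] ℝ :=
    LinearMap.mk₂ ℝ (fun X T => (Xᴴ * T).trace.re)
      (fun X Y T => by simp [Matrix.add_mul])
      (fun c X T => by simp)
      (fun X S T => by simp [Matrix.mul_add])
      (fun c X T => by simp)
  let μ' : Measure (m → n → ℂ) := μ
  let ν' : Measure (m → n → ℂ) := ν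
  have : IsFiniteMeasure μ' := ‹IsFiniteMeasure μ›
  have : IsFiniteMeasure ν' := ‹IsFiniteMeasure ν›
  refine ext_of_integral_char_eq (V := m → n → ℂ) (L := pairing) (P := μ') (P' := ν')
    Real.continuous_probChar Real.probChar_ne_one (fun (X : Matrix m n ℂ) hX hpair => ?_)
    (by change Continuous fun p : Matrix m n ℂ × Matrix m n ℂ => (p.1ᴴ * p.2).trace.re; fun_prop)
    (congrFun h)
  have hself : (Xᴴ * X).trace.re = 0 := LinearMap.congr_fun hpair X
  rw [trace_conjTranspose_mul_self, Complex.ofReal_re] at hself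
  exact hX (frobeniusSq_eq_zero.1 hself)

/-- The law of a matrix with i.i.d. standard complex Gaussian entries. -/
noncomputable def ginibre (m n : Type*) [Fintype m] [Fintype n] : Measure (Matrix m n ℂ) :=
  Measure.pi fun _ : m => Measure.pi fun _ : n => complexGaussian

theorem measurable_complexMk : Measurable fun p : ℝ × ℝ => Complex.mk p.1 p.2 :=
  Complex.measurableEquivRealProd.symm.measurable

instance isProbabilityMeasure_complexGaussian : IsProbabilityMeasure complexGaussian :=
  Measure.isProbabilityMeasure_map measurable_complexMk.aemeasurable

instance isProbabilityMeasure_ginibre : IsProbabilityMeasure (ginibre m n) :=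
  inferInstanceAs (IsProbabilityMeasure
    (Measure.pi fun _ : m => Measure.pi fun _ : n => complexGaussian))

theorem charFun_complexGaussian (t : ℂ) :
    charFun complexGaussian t = Complex.exp (-(‖t‖ ^ 2 / 4 : ℝ)) := by
  have hexp (p : ℝ × ℝ) : Complex.exp ((inner ℝ (Complex.mk p.1 p.2) t : ℝ) * Complex.I) =
      Complex.exp (t.re * p.1 * Complex.I) * Complex.exp (t.im * p.2 * Complex.I) := by
    rw [← Complex.exp_add, Complex.inner]
    congr 1
    simp only [Complex.mul_re, Complex.conj_re, Complex.conj_im]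
    push_cast
    ring
  rw [charFun_apply, complexGaussian,
    integral_map measurable_complexMk.aemeasurable (by fun_prop)]
  simp_rw [hexp]
  rw [integral_prod_mul (fun x : ℝ => Complex.exp (t.re * x * Complex.I))
    (fun y : ℝ => Complex.exp (t.im * y * Complex.I)), ← charFun_apply_real, ← charFun_apply_real,
    charFun_gaussianReal, charFun_gaussianReal, ← Complex.exp_add, ← Complex.normSq_eq_norm_sq,
    Complex.normSq_apply]
  congr 1
  push_cast
  ring

theorem matrixCharFun_ginibre (T : Matrix m n ℂ) :
    matrixCharFun (ginibre m n) T = Complex.exp (-(frobeniusSq T / 4 : ℝ)) := by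
  calc matrixCharFun (ginibre m n) T
      = ∫ X : m → n → ℂ, ∏ i, ∏ j, Complex.exp ((inner ℝ (X i j) (T i j) : ℝ) * Complex.I)
          ∂(Measure.pi fun _ => Measure.pi fun _ => complexGaussian) := by
        refine integral_congr_ae (ae_of_all _ fun X => ?_)
        simp_rw [← Complex.exp_sum]
        congr 1
        rw [trace_conjTranspose_mul]
        simp only [Complex.inner, Complex.re_sum, Complex.ofReal_sum, Finset.sum_mul,
          Complex.star_def, mul_comm (T _ _)]
    _ = ∏ i, ∏ j, charFun complexGaussian (T i j) := by
        rw [integral_fintype_prod_eq_prod (fun i (x : n → ℂ) =>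
          ∏ j, Complex.exp ((inner ℝ (x j) (T i j) : ℝ) * Complex.I))]
        refine Finset.prod_congr rfl fun i _ => ?_
        exact integral_fintype_prod_eq_prod
          (fun j (z : ℂ) => Complex.exp ((inner ℝ z (T i j) : ℝ) * Complex.I))
    _ = Complex.exp (-(frobeniusSq T / 4 : ℝ)) := by
        simp_rw [charFun_complexGaussian, ← Complex.exp_sum, frobeniusSq, Finset.sum_div]
        push_cast
        simp only [Finset.sum_neg_distrib]

theorem measurePreserving_ginibre_of_adjoint {f : Matrix m n ℂ → Matrix m' n' ℂ}
    {g : Matrix m' n' ℂ → Matrix m n ℂ} (hf : Measurable f)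
    (hadj : ∀ X T, ((f X)ᴴ * T).trace.re = (Xᴴ * g T).trace.re)
    (hg : ∀ T, frobeniusSq (g T) = frobeniusSq T) :
    MeasurePreserving f (ginibre m n) (ginibre m' n') := by
  have := Measure.isProbabilityMeasure_map (μ := ginibre m n) hf.aemeasurable
  refine ⟨hf, measure_ext_of_matrixCharFun (funext fun T => ?_)⟩
  calc matrixCharFun ((ginibre m n).map f) T
      = matrixCharFun (ginibre m n) (g T) := by
        rw [matrixCharFun, integral_map hf.aemeasurable
          (Continuous.aestronglyMeasurable (by fun_prop))]
        simp only [hadj, matrixCharFun]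
    _ = matrixCharFun (ginibre m' n') T := by
        rw [matrixCharFun_ginibre, matrixCharFun_ginibre, hg]

theorem measurePreserving_conjTranspose_ginibre :
    MeasurePreserving (fun X : Matrix m n ℂ => Xᴴ) (ginibre m n) (ginibre n m) := by
  refine measurePreserving_ginibre_of_adjoint (g := fun T => Tᴴ)
    (Continuous.measurable (by fun_prop)) (fun X T => ?_) fun T => ?_
  · rw [Matrix.conjTranspose_conjTranspose, ← Complex.conj_re, ← Complex.star_def,
      ← Matrix.trace_conjTranspose, Matrix.conjTranspose_mul, Matrix.trace_mul_comm]
  · simp only [frobeniusSq, Matrix.conjTranspose_apply, norm_star]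
    exact Finset.sum_comm

variable [DecidableEq m'] [DecidableEq n']

theorem frobeniusSq_isometry_mul_mul {A : Matrix m m' ℂ} {B : Matrix n n' ℂ}
    (hA : Aᴴ * A = 1) (hB : Bᴴ * B = 1) (T : Matrix m' n' ℂ) :
    frobeniusSq (A * T * Bᴴ) = frobeniusSq T := by
  rw [← Complex.ofReal_inj, ← trace_conjTranspose_mul_self, ← trace_conjTranspose_mul_self]
  calc ((A * T * Bᴴ)ᴴ * (A * T * Bᴴ)).trace
      = (B * (Tᴴ * (Aᴴ * A) * T * Bᴴ)).trace := by
        simp only [Matrix.conjTranspose_mul, Matrix.conjTranspose_conjTranspose, Matrix.mul_assoc]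
    _ = (Tᴴ * T).trace := by
        rw [Matrix.trace_mul_comm, Matrix.mul_assoc, hA, hB, Matrix.mul_one, Matrix.mul_one]

theorem measurePreserving_isometry_mul_mul_ginibre {A : Matrix m m' ℂ} {B : Matrix n n' ℂ}
    (hA : Aᴴ * A = 1) (hB : Bᴴ * B = 1) :
    MeasurePreserving (fun X => Aᴴ * X * B) (ginibre m n) (ginibre m' n') := by
  refine measurePreserving_ginibre_of_adjoint (g := fun T => A * T * Bᴴ)
    (Continuous.measurable (by fun_prop)) (fun X T => ?_) (frobeniusSq_isometry_mul_mul hA hB)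
  simp only [Matrix.conjTranspose_mul, Matrix.conjTranspose_conjTranspose]
  rw [Matrix.mul_assoc, Matrix.trace_mul_comm]
  simp only [Matrix.mul_assoc]

end Ginibre

section GaussianTransfer

open scoped ENNReal

variable {n : Type*} [Fintype n]

/-- Left multiplication by `P * G`, with `G` a Ginibre matrix, as a Markov operator: it sends `φ`
to `X ↦ 𝔼 φ (P * G * X)`. -/
noncomputable def gaussianTransfer (P : Matrix n n ℂ) (φ : Matrix n n ℂ → ℝ≥0∞) :
    Matrix n n ℂ → ℝ≥0∞ :=
  fun X => ∫⁻ G, φ (P * G * X) ∂ginibre n n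

theorem measurable_gaussianTransfer_left {φ : Matrix n n ℂ → ℝ≥0∞} (hφ : Measurable φ)
    (X : Matrix n n ℂ) : Measurable fun P => gaussianTransfer P φ X :=
  Measurable.lintegral_prod_right' (f := fun p : Matrix n n ℂ × Matrix n n ℂ => φ (p.1 * p.2 * X))
    (hφ.comp (Continuous.measurable (by fun_prop)))

theorem measurable_gaussianTransfer_right {φ : Matrix n n ℂ → ℝ≥0∞} (hφ : Measurable φ)
    (P : Matrix n n ℂ) : Measurable (gaussianTransfer P φ) :=
  Measurable.lintegral_prod_right' (f := fun p : Matrix n n ℂ × Matrix n n ℂ => φ (P * p.2 * p.1))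
    (hφ.comp (Continuous.measurable (by fun_prop)))

theorem measurable_foldr_gaussianTransfer {φ : Matrix n n ℂ → ℝ≥0∞} (hφ : Measurable φ)
    (L : List (Matrix n n ℂ)) : Measurable (L.foldr gaussianTransfer φ) := by
  induction L with
  | nil => exact hφ
  | cons P L ih => exact measurable_gaussianTransfer_right ih P

theorem gaussianTransfer_gaussianTransfer {φ : Matrix n n ℂ → ℝ≥0∞} (hφ : Measurable φ)
    (P Q X : Matrix n n ℂ) :
    gaussianTransfer P (gaussianTransfer Q φ) X =
      gaussianTransfer Q (fun M => gaussianTransfer M φ X) P :=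
  calc gaussianTransfer P (gaussianTransfer Q φ) X
      = ∫⁻ G', ∫⁻ G, φ (Q * G * (P * G' * X)) ∂ginibre n n ∂ginibre n n := rfl
    _ = ∫⁻ G, ∫⁻ G', φ (Q * G * (P * G' * X)) ∂ginibre n n ∂ginibre n n :=
        lintegral_lintegral_swap (hφ.comp (Continuous.measurable (by fun_prop))).aemeasurable
    _ = gaussianTransfer Q (fun M => gaussianTransfer M φ X) P := by
        simp only [gaussianTransfer, Matrix.mul_assoc]

variable [DecidableEq n]

/-- Invariance of a function of a square matrix under multiplication by unitary matrices on either
side; equivalently, the function depends on the singular values only. -/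
def IsBiunitarilyInvariant {α : Type*} (φ : Matrix n n ℂ → α) : Prop :=
  ∀ U ∈ Matrix.unitaryGroup n ℂ, ∀ V ∈ Matrix.unitaryGroup n ℂ, ∀ X, φ (U * X * V) = φ X

theorem IsBiunitarilyInvariant.comp {α β : Type*} {φ : Matrix n n ℂ → α}
    (hφ : IsBiunitarilyInvariant φ) (f : α → β) : IsBiunitarilyInvariant fun X => f (φ X) :=
  fun U hU V hV X => congrArg f (hφ U hU V hV X)

theorem IsBiunitarilyInvariant.mul_left {α : Type*} {φ : Matrix n n ℂ → α}
    (hφ : IsBiunitarilyInvariant φ) {U : Matrix n n ℂ} (hU : U ∈ Matrix.unitaryGroup n ℂ)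
    (X : Matrix n n ℂ) : φ (U * X) = φ X := by
  rw [← hφ U hU 1 (one_mem _) X, Matrix.mul_one]

theorem IsBiunitarilyInvariant.mul_right {α : Type*} {φ : Matrix n n ℂ → α}
    (hφ : IsBiunitarilyInvariant φ) {V : Matrix n n ℂ} (hV : V ∈ Matrix.unitaryGroup n ℂ)
    (X : Matrix n n ℂ) : φ (X * V) = φ X := by
  rw [← hφ 1 (one_mem _) V hV X, Matrix.one_mul]

theorem IsBiunitarilyInvariant.conjTranspose {α : Type*} {φ : Matrix n n ℂ → α}
    (hφ : IsBiunitarilyInvariant φ) (X : Matrix n n ℂ) : φ Xᴴ = φ X := by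
  obtain ⟨U, hU, V, hV, hX⟩ := exists_unitary_conjTranspose_eq X
  rw [hX, hφ U hU V hV]

variable {φ : Matrix n n ℂ → ℝ≥0∞}

theorem lintegral_mul_left_ginibre {U : Matrix n n ℂ} (hU : U ∈ Matrix.unitaryGroup n ℂ)
    {f : Matrix n n ℂ → ℝ≥0∞} (hf : Measurable f) :
    ∫⁻ G, f (U * G) ∂ginibre n n = ∫⁻ G, f G ∂ginibre n n := by
  have h := measurePreserving_isometry_mul_mul_ginibre (A := Uᴴ) (B := (1 : Matrix n n ℂ))
    (by rw [Matrix.conjTranspose_conjTranspose]; exact Matrix.mem_unitaryGroup_iff.1 hU)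
    (by rw [Matrix.conjTranspose_one, Matrix.one_mul])
  simpa only [Matrix.conjTranspose_conjTranspose, Matrix.mul_one] using h.lintegral_comp hf

theorem lintegral_mul_right_ginibre {V : Matrix n n ℂ} (hV : V ∈ Matrix.unitaryGroup n ℂ)
    {f : Matrix n n ℂ → ℝ≥0∞} (hf : Measurable f) :
    ∫⁻ G, f (G * V) ∂ginibre n n = ∫⁻ G, f G ∂ginibre n n := by
  have h := measurePreserving_isometry_mul_mul_ginibre (A := (1 : Matrix n n ℂ)) (B := V)
    (by rw [Matrix.conjTranspose_one, Matrix.one_mul]) (Matrix.mem_unitaryGroup_iff'.1 hV)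
  simpa only [Matrix.conjTranspose_one, Matrix.one_mul] using h.lintegral_comp hf

theorem IsBiunitarilyInvariant.gaussianTransfer_left (hφ : IsBiunitarilyInvariant φ)
    (hm : Measurable φ) (X : Matrix n n ℂ) :
    IsBiunitarilyInvariant fun P => gaussianTransfer P φ X := by
  intro U hU V hV P
  calc ∫⁻ G, φ (U * P * V * G * X) ∂ginibre n n
      = ∫⁻ G, φ (P * (V * G) * X) ∂ginibre n n := by
        refine lintegral_congr fun G => ?_
        rw [← hφ.mul_left hU (P * (V * G) * X)]
        simp only [Matrix.mul_assoc]
    _ = ∫⁻ G, φ (P * G * X) ∂ginibre n n :=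
        lintegral_mul_left_ginibre hV (f := fun G => φ (P * G * X))
          (hm.comp (Continuous.measurable (by fun_prop)))

theorem IsBiunitarilyInvariant.gaussianTransfer_right (hφ : IsBiunitarilyInvariant φ)
    (hm : Measurable φ) (P : Matrix n n ℂ) :
    IsBiunitarilyInvariant (gaussianTransfer P φ) := by
  intro U hU V hV X
  calc ∫⁻ G, φ (P * G * (U * X * V)) ∂ginibre n n
      = ∫⁻ G, φ (P * (G * U) * X) ∂ginibre n n := by
        refine lintegral_congr fun G => ?_
        rw [← hφ.mul_right hV (P * (G * U) * X)]
        simp only [Matrix.mul_assoc]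
    _ = ∫⁻ G, φ (P * G * X) ∂ginibre n n :=
        lintegral_mul_right_ginibre hU (f := fun G => φ (P * G * X))
          (hm.comp (Continuous.measurable (by fun_prop)))

theorem IsBiunitarilyInvariant.foldr_gaussianTransfer (hφ : IsBiunitarilyInvariant φ)
    (hm : Measurable φ) (L : List (Matrix n n ℂ)) :
    IsBiunitarilyInvariant (L.foldr gaussianTransfer φ) := by
  induction L with
  | nil => exact hφ
  | cons P L ih => exact ih.gaussianTransfer_right (measurable_foldr_gaussianTransfer hm L) P

theorem gaussianTransfer_symm (hφ : IsBiunitarilyInvariant φ) (hm : Measurable φ)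
    (P Q : Matrix n n ℂ) : gaussianTransfer P φ Q = gaussianTransfer Q φ P :=
  calc gaussianTransfer P φ Q
      = gaussianTransfer P φ Qᴴ := ((hφ.gaussianTransfer_right hm P).conjTranspose Q).symm
    _ = ∫⁻ G, φ (Q * Gᴴ * Pᴴ) ∂ginibre n n := by
        refine lintegral_congr fun G => ?_
        rw [← hφ.conjTranspose]
        simp only [Matrix.conjTranspose_mul, Matrix.conjTranspose_conjTranspose, Matrix.mul_assoc]
    _ = gaussianTransfer Q φ Pᴴ :=
        measurePreserving_conjTranspose_ginibre.lintegral_comp (f := fun G => φ (Q * G * Pᴴ))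
          (hm.comp (Continuous.measurable (by fun_prop)))
    _ = gaussianTransfer Q φ P := (hφ.gaussianTransfer_right hm Q).conjTranspose P

theorem gaussianTransfer_comm (hφ : IsBiunitarilyInvariant φ) (hm : Measurable φ)
    (P Q : Matrix n n ℂ) :
    gaussianTransfer P (gaussianTransfer Q φ) = gaussianTransfer Q (gaussianTransfer P φ) := by
  funext X
  rw [gaussianTransfer_gaussianTransfer hm, gaussianTransfer_gaussianTransfer hm,
    gaussianTransfer_symm (hφ.gaussianTransfer_left hm X) (measurable_gaussianTransfer_left hm X)]

theorem foldr_gaussianTransfer_perm (hφ : IsBiunitarilyInvariant φ) (hm : Measurable φ)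
    {L L' : List (Matrix n n ℂ)} (h : L.Perm L') :
    L.foldr gaussianTransfer φ = L'.foldr gaussianTransfer φ := by
  induction h with
  | nil => rfl
  | cons P _ ih => rw [List.foldr_cons, List.foldr_cons, ih]
  | swap P Q L =>
    exact gaussianTransfer_comm (hφ.foldr_gaussianTransfer hm L)
      (measurable_foldr_gaussianTransfer hm L) Q P
  | trans _ _ ih ih' => exact ih.trans ih'

/-- The expectation of `φ (Pₖ * Gₖ * ⋯ * P₁ * G₁ * P₀)` with independent Ginibre matrices `Gᵢ`, as
a function of the list `[P₀, P₁, …, Pₖ]`; the value at the empty list is irrelevant. -/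
noncomputable def productAverage (φ : Matrix n n ℂ → ℝ≥0∞) : List (Matrix n n ℂ) → ℝ≥0∞
  | [] => 0
  | P :: L => L.foldr gaussianTransfer φ P

theorem productAverage_perm (hφ : IsBiunitarilyInvariant φ) (hm : Measurable φ)
    {L L' : List (Matrix n n ℂ)} (h : L.Perm L') : productAverage φ L = productAverage φ L' := by
  induction h with
  | nil => rfl
  | cons P h _ => exact congrFun (foldr_gaussianTransfer_perm hφ hm h) P
  | swap P Q L =>
    exact gaussianTransfer_symm (hφ.foldr_gaussianTransfer hm L)
      (measurable_foldr_gaussianTransfer hm L) P Q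
  | trans _ _ ih ih' => exact ih.trans ih'

end GaussianTransfer

section LogDet

open scoped ComplexOrder

section PosSemidef

variable {𝕜 n : Type*} [RCLike 𝕜] [Fintype n] [DecidableEq n] {A : Matrix n n 𝕜}

theorem det_one_add_eq_prod_eigenvalues (hA : A.IsHermitian) :
    (1 + A).det = ((∏ i, (1 + hA.eigenvalues i) : ℝ) : 𝕜) := by
  have hneg : 1 + A = -(Matrix.scalar n (-1) - A) := by
    rw [map_neg, map_one]
    abel
  rw [hneg, Matrix.det_neg, ← Matrix.eval_charpoly, hA.charpoly_eq, Polynomial.eval_prod,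
    ← Finset.card_univ, ← Finset.prod_const, ← Finset.prod_mul_distrib]
  push_cast
  refine Finset.prod_congr rfl fun i _ => ?_
  rw [Polynomial.eval_sub, Polynomial.eval_X, Polynomial.eval_C]
  ring

theorem log_det_one_add_nonneg (hA : A.PosSemidef) : 0 ≤ Real.log (RCLike.re (1 + A).det) := by
  rw [det_one_add_eq_prod_eigenvalues hA.isHermitian, RCLike.ofReal_re]
  exact Real.log_nonneg
    (Finset.one_le_prod fun i _ => le_add_of_nonneg_right (hA.eigenvalues_nonneg i))

theorem log_det_one_add_le_trace (hA : A.PosSemidef) :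
    Real.log (RCLike.re (1 + A).det) ≤ RCLike.re A.trace := by
  have hpos (i : n) : 0 < 1 + hA.isHermitian.eigenvalues i :=
    add_pos_of_pos_of_nonneg one_pos (hA.eigenvalues_nonneg i)
  rw [det_one_add_eq_prod_eigenvalues hA.isHermitian, hA.isHermitian.trace_eq_sum_eigenvalues,
    ← RCLike.ofReal_sum, RCLike.ofReal_re, RCLike.ofReal_re,
    Real.log_prod fun i _ => (hpos i).ne']
  exact Finset.sum_le_sum fun i _ =>
    (Real.log_le_sub_one_of_pos (hpos i)).trans_eq (add_sub_cancel_left _ _)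

end PosSemidef

variable {m n : Type*} [Fintype m]

theorem posSemidef_smul_conjTranspose_mul_self [Finite n] {q : ℝ} (hq : 0 ≤ q)
    (X : Matrix m n ℂ) : ((q : ℂ) • (Xᴴ * X)).PosSemidef :=
  (Matrix.posSemidef_conjTranspose_mul_self X).smul (Complex.zero_le_real.2 hq)

variable [Fintype n] [DecidableEq n]

/-- The capacity `log det (1 + q Xᴴ X)` of a deterministic channel matrix `X`. -/
noncomputable def logDet (q : ℝ) (X : Matrix m n ℂ) : ℝ :=
  Real.log (1 + (q : ℂ) • (Xᴴ * X)).det.re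

theorem logDet_nonneg {q : ℝ} (hq : 0 ≤ q) (X : Matrix m n ℂ) : 0 ≤ logDet q X :=
  log_det_one_add_nonneg (posSemidef_smul_conjTranspose_mul_self hq X)

theorem logDet_le {q : ℝ} (hq : 0 ≤ q) (X : Matrix m n ℂ) : logDet q X ≤ q * frobeniusSq X := by
  refine (log_det_one_add_le_trace (posSemidef_smul_conjTranspose_mul_self hq X)).trans_eq ?_
  rw [Matrix.trace_smul, trace_conjTranspose_mul_self, smul_eq_mul, ← Complex.ofReal_mul]
  exact Complex.ofReal_re _

theorem measurable_logDet (q : ℝ) : Measurable (logDet q : Matrix m n ℂ → ℝ) :=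
  Real.measurable_log.comp (Complex.continuous_re.comp
    (Continuous.matrix_det (by fun_prop))).measurable

theorem logDet_isometry_mul_mul {m' n' : Type*} [Fintype m'] [Fintype n'] [DecidableEq m]
    [DecidableEq n'] (q : ℝ) {A : Matrix m' m ℂ} {B : Matrix n' n ℂ} (hA : Aᴴ * A = 1)
    (hB : Bᴴ * B = 1) (X : Matrix m n ℂ) : logDet q (A * X * Bᴴ) = logDet q X := by
  have hgram : (q : ℂ) • ((A * X * Bᴴ)ᴴ * (A * X * Bᴴ)) = B * ((q : ℂ) • (Xᴴ * X) * Bᴴ) := by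
    calc (q : ℂ) • ((A * X * Bᴴ)ᴴ * (A * X * Bᴴ))
        = (q : ℂ) • (B * (Xᴴ * ((Aᴴ * A) * X) * Bᴴ)) := by
          simp only [Matrix.conjTranspose_mul, Matrix.conjTranspose_conjTranspose,
            Matrix.mul_assoc]
      _ = B * ((q : ℂ) • (Xᴴ * X) * Bᴴ) := by
          rw [hA, Matrix.one_mul, Matrix.smul_mul, Matrix.mul_smul]
  -- Sylvester's identity moves `B` to the right of the Gram matrix, where it cancels.
  rw [logDet, hgram, Matrix.det_one_add_mul_comm, Matrix.mul_assoc, hB, Matrix.mul_one, logDet]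

theorem isBiunitarilyInvariant_logDet (q : ℝ) :
    IsBiunitarilyInvariant (logDet q : Matrix n n ℂ → ℝ) := by
  intro U hU V hV X
  have h := logDet_isometry_mul_mul q (A := U) (B := Vᴴ) (Matrix.mem_unitaryGroup_iff'.1 hU)
    (by rw [Matrix.conjTranspose_conjTranspose]; exact Matrix.mem_unitaryGroup_iff.1 hV) X
  rwa [Matrix.conjTranspose_conjTranspose] at h

end LogDet

section Integrability

variable {l m n : Type*} [Fintype l] [Fintype m] [Fintype n]

theorem frobeniusSq_nonneg (X : Matrix m n ℂ) : 0 ≤ frobeniusSq X :=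
  Finset.sum_nonneg fun _ _ => Finset.sum_nonneg fun _ _ => sq_nonneg _

section FrobeniusNorm

attribute [local instance] Matrix.frobeniusSeminormedAddCommGroup

theorem frobeniusSq_eq_norm_sq (X : Matrix m n ℂ) : frobeniusSq X = ‖X‖ ^ 2 := by
  rw [Matrix.frobenius_norm_def, ← Real.sqrt_eq_rpow]
  simp_rw [Real.rpow_two]
  exact (Real.sq_sqrt (frobeniusSq_nonneg X)).symm

theorem frobeniusSq_mul_le (X : Matrix l m ℂ) (Y : Matrix m n ℂ) :
    frobeniusSq (X * Y) ≤ frobeniusSq X * frobeniusSq Y := by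
  simp only [frobeniusSq_eq_norm_sq, ← mul_pow]
  gcongr
  exact Matrix.frobenius_norm_mul X Y

end FrobeniusNorm

theorem integrable_norm_sq_complexGaussian :
    Integrable (fun z : ℂ => ‖z‖ ^ 2) complexGaussian := by
  rw [complexGaussian, integrable_map_measure (by fun_prop) measurable_complexMk.aemeasurable]
  have h : Integrable (fun x : ℝ => x ^ 2) (gaussianReal 0 (1 / 2)) :=
    (memLp_id_gaussianReal (μ := 0) (v := 1 / 2) 2).integrable_sq
  refine ((h.comp_fst _).add (h.comp_snd _)).congr (ae_of_all _ fun p => ?_)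
  rw [Function.comp_apply, ← Complex.normSq_eq_norm_sq, Complex.normSq_apply]
  simp only [Pi.add_apply, sq]

theorem integrable_frobeniusSq_ginibre : Integrable frobeniusSq (ginibre m n) := by
  refine integrable_finsetSum _ fun i _ => integrable_finsetSum _ fun j _ => ?_
  have h : MeasurePreserving (fun X : m → n → ℂ => X i j)
      (Measure.pi fun _ => Measure.pi fun _ => complexGaussian) complexGaussian :=
    (measurePreserving_eval (fun _ : n => complexGaussian) j).comp
      (measurePreserving_eval (fun _ : m => Measure.pi fun _ : n => complexGaussian) i)
  exact h.integrable_comp_of_integrable integrable_norm_sq_complexGaussian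

variable {K : ℕ} {N : Fin (K + 1) → ℕ}

/-- The product `Qₖ * ⋯ * Q₁` of the first `k` component channels. -/
noncomputable def partialChannel (Q : Channels N) (k : Fin (K + 1)) :
    Matrix (Fin (N k)) (Fin (N 0)) ℂ :=
  Fin.induction (motive := fun k => Matrix (Fin (N k)) (Fin (N 0)) ℂ)
    1 (fun k P => Matrix.of (Q k) * P) k

theorem partialChannel_zero (Q : Channels N) : partialChannel Q 0 = 1 := rfl

theorem partialChannel_succ (Q : Channels N) (k : Fin K) :
    partialChannel Q k.succ = Matrix.of (Q k) * partialChannel Q k.castSucc := rfl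

theorem partialChannel_last (Q : Channels N) :
    partialChannel Q (Fin.last K) = productChannel Q := rfl

theorem continuous_partialChannel (k : Fin (K + 1)) :
    Continuous fun Q : Channels N => partialChannel Q k := by
  induction k using Fin.induction with
  | zero => exact continuous_const
  | succ k ih => exact Continuous.matrix_mul (continuous_apply k) ih

theorem frobeniusSq_partialChannel_le (Q : Channels N) (k : Fin (K + 1)) :
    frobeniusSq (partialChannel Q k) ≤
      frobeniusSq (1 : Matrix (Fin (N 0)) (Fin (N 0)) ℂ) *
        Fin.partialProd (fun j => frobeniusSq (Matrix.of (Q j))) k := by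
  induction k using Fin.induction with
  | zero => rw [partialChannel_zero, Fin.partialProd_zero, mul_one]
  | succ k ih =>
    rw [partialChannel_succ, Fin.partialProd_succ, ← mul_assoc, mul_comm _ (frobeniusSq _)]
    exact (frobeniusSq_mul_le _ _).trans (mul_le_mul_of_nonneg_left ih (frobeniusSq_nonneg _))

theorem frobeniusSq_productChannel_le (Q : Channels N) :
    frobeniusSq (productChannel Q) ≤
      frobeniusSq (1 : Matrix (Fin (N 0)) (Fin (N 0)) ℂ) *
        ∏ k, frobeniusSq (Matrix.of (Q k)) := by
  have h := frobeniusSq_partialChannel_le Q (Fin.last K)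
  rwa [Fin.partialProd, Fin.val_last, List.take_of_length_le (List.length_ofFn).le,
    List.prod_ofFn] at h

theorem measurable_capacity (q : ℝ) : Measurable (capacity q : Channels N → ℝ) :=
  (measurable_logDet q).comp (continuous_partialChannel (Fin.last K)).measurable

theorem capacity_nonneg {q : ℝ} (hq : 0 ≤ q) (Q : Channels N) : 0 ≤ capacity q Q :=
  logDet_nonneg hq (productChannel Q)

theorem integrable_capacity {q : ℝ} (hq : 0 ≤ q) :
    Integrable (fun Q : Channels N => capacity q Q) (rayleighLaw N) := by
  have hprod : Integrable (fun Q : Channels N => ∏ k, frobeniusSq (Matrix.of (Q k)))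
      (rayleighLaw N) :=
    Integrable.fintype_prod_dep
      (f := fun (k : Fin K) (X : Fin (N k.succ) → Fin (N k.castSucc) → ℂ) =>
        frobeniusSq (Matrix.of X))
      fun k => integrable_frobeniusSq_ginibre
  refine ((hprod.const_mul (frobeniusSq (1 : Matrix (Fin (N 0)) (Fin (N 0)) ℂ))).const_mul q).mono'
    (measurable_capacity q).aestronglyMeasurable (ae_of_all _ fun Q => ?_)
  rw [Real.norm_of_nonneg (capacity_nonneg hq Q)]
  exact (logDet_le hq (productChannel Q)).trans
    (mul_le_mul_of_nonneg_left (frobeniusSq_productChannel_le Q) hq)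

end Integrability

section Embedding

open scoped ENNReal

theorem eq_prod_reverse_ofFn_mul {M : Type*} [Monoid M] {K : ℕ} (A : Fin K → M)
    (B : Fin (K + 1) → M) (hB : ∀ k : Fin K, B k.succ = A k * B k.castSucc) :
    B (Fin.last K) = (List.ofFn A).reverse.prod * B 0 := by
  induction K with
  | zero => rw [List.ofFn_zero, List.reverse_nil, List.prod_nil, one_mul]; rfl
  | succ K ih =>
    rw [List.ofFn_succ, List.reverse_cons, List.prod_append, List.prod_singleton, mul_assoc,
      ← Fin.succ_last, ih (fun k => A k.succ) (fun k => B k.succ) fun k => hB k.succ]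
    exact congrArg _ (hB 0)

variable {n : Type*} [Fintype n] {K : ℕ} {N : Fin (K + 1) → ℕ}

/-- The channels `Eₖᴴ * Gₖ * Eₖ₋₁` of dimensions `N` cut out of square matrices `Gₖ`. If each `Eₖ`
has orthonormal columns, they are the blocks of the `Gₖ` in these orthonormal systems. -/
noncomputable def compress (E : (k : Fin (K + 1)) → Matrix n (Fin (N k)) ℂ)
    (G : Fin K → Matrix n n ℂ) : Channels N :=
  fun k => (E k.succ)ᴴ * G k * E k.castSucc

theorem measurePreserving_compress {E : (k : Fin (K + 1)) → Matrix n (Fin (N k)) ℂ}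
    (hE : ∀ k, (E k)ᴴ * E k = 1) :
    MeasurePreserving (compress E) (Measure.pi fun _ : Fin K => ginibre n n) (rayleighLaw N) :=
  measurePreserving_pi (fun _ : Fin K => ginibre n n)
    (fun k => ginibre (Fin (N k.succ)) (Fin (N k.castSucc)))
    (f := fun (k : Fin K) (G : Matrix n n ℂ) => (E k.succ)ᴴ * G * E k.castSucc)
    fun k => measurePreserving_isometry_mul_mul_ginibre (hE k.succ) (hE k.castSucc)

variable [DecidableEq n]

theorem lintegral_prod_reverse_ofFn_mul {φ : Matrix n n ℂ → ℝ≥0∞} (hφ : Measurable φ)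
    (P : Fin K → Matrix n n ℂ) (X : Matrix n n ℂ) :
    ∫⁻ G, φ ((List.ofFn fun k => P k * G k).reverse.prod * X)
      ∂(Measure.pi fun _ : Fin K => ginibre n n) = (List.ofFn P).foldr gaussianTransfer φ X := by
  induction K generalizing X with
  | zero => simp
  | succ K ih =>
    have hmp := measurePreserving_piFinSuccAbove (fun _ : Fin (K + 1) => ginibre n n) 0
    have hm : Measurable fun p : Matrix n n ℂ × (Fin K → Matrix n n ℂ) =>
        φ ((List.ofFn fun k => P k.succ * p.2 k).reverse.prod * (P 0 * p.1 * X)) := by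
      refine hφ.comp (Continuous.measurable (Continuous.matrix_mul ?_ (by fun_prop)))
      simp_rw [List.ofFn_eq_map, ← List.map_reverse]
      exact continuous_list_prod _ fun k _ => by fun_prop
    calc ∫⁻ G, φ ((List.ofFn fun k => P k * G k).reverse.prod * X)
          ∂(Measure.pi fun _ : Fin (K + 1) => ginibre n n)
        = ∫⁻ G, φ ((List.ofFn fun k => P k.succ * G k.succ).reverse.prod * (P 0 * G 0 * X))
            ∂(Measure.pi fun _ : Fin (K + 1) => ginibre n n) := by
          simp only [List.ofFn_succ, List.reverse_cons, List.prod_append, List.prod_singleton,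
            Matrix.mul_assoc]
      _ = ∫⁻ p, φ ((List.ofFn fun k => P k.succ * p.2 k).reverse.prod * (P 0 * p.1 * X))
            ∂((ginibre n n).prod (Measure.pi fun _ : Fin K => ginibre n n)) :=
          hmp.lintegral_comp hm
      _ = (List.ofFn P).foldr gaussianTransfer φ X := by
          rw [lintegral_prod _ hm.aemeasurable, List.ofFn_succ, List.foldr_cons]
          exact lintegral_congr fun G => ih (fun k => P k.succ) (P 0 * G * X)

theorem mul_productChannel_compress_mul (E : (k : Fin (K + 1)) → Matrix n (Fin (N k)) ℂ)
    (G : Fin K → Matrix n n ℂ) :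
    E (Fin.last K) * productChannel (compress E G) * (E 0)ᴴ =
      (List.ofFn fun k : Fin K => E k.succ * (E k.succ)ᴴ * G k).reverse.prod *
        (E 0 * (E 0)ᴴ) := by
  have h := eq_prod_reverse_ofFn_mul (fun k : Fin K => E k.succ * (E k.succ)ᴴ * G k)
    (fun k => E k * partialChannel (compress E G) k * (E 0)ᴴ) fun k => by
      have hQ : Matrix.of (compress E G k) = (E k.succ)ᴴ * G k * E k.castSucc := rfl
      simp only [partialChannel_succ, hQ, Matrix.mul_assoc]
  rwa [partialChannel_last, partialChannel_zero, Matrix.mul_one] at h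

theorem lintegral_capacity {E : (k : Fin (K + 1)) → Matrix n (Fin (N k)) ℂ}
    (hE : ∀ k, (E k)ᴴ * E k = 1) (q : ℝ) :
    ∫⁻ Q, ENNReal.ofReal (capacity q Q) ∂(rayleighLaw N) =
      productAverage (fun X => ENNReal.ofReal (logDet q X))
        (List.ofFn fun k => E k * (E k)ᴴ) := by
  have hcapacity (G : Fin K → Matrix n n ℂ) : capacity q (compress E G) =
      logDet q ((List.ofFn fun k : Fin K => E k.succ * (E k.succ)ᴴ * G k).reverse.prod *
        (E 0 * (E 0)ᴴ)) := by
    rw [← mul_productChannel_compress_mul, logDet_isometry_mul_mul q (hE _) (hE _)]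
    rfl
  rw [← (measurePreserving_compress hE).lintegral_comp (measurable_capacity q).ennreal_ofReal]
  simp only [hcapacity]
  rw [lintegral_prod_reverse_ofFn_mul (φ := fun X => ENNReal.ofReal (logDet q X))
    (measurable_logDet q).ennreal_ofReal, List.ofFn_succ, productAverage]

theorem exists_conjTranspose_mul_self_eq_one {m d : ℕ} (h : m ≤ d) :
    ∃ E : Matrix (Fin d) (Fin m) ℂ, Eᴴ * E = 1 := by
  refine ⟨(1 : Matrix (Fin d) (Fin d) ℂ).submatrix id (Fin.castLE h), ?_⟩
  rw [Matrix.conjTranspose_submatrix, Matrix.conjTranspose_one,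
    ← Matrix.submatrix_mul _ _ _ _ _ Function.bijective_id, Matrix.one_mul]
  exact Matrix.submatrix_one _ (Fin.castLE_injective h)

theorem ergodicCapacity_eq_toReal_lintegral {q : ℝ} (hq : 0 ≤ q) (N : Fin (K + 1) → ℕ) :
    ergodicCapacity N q = (∫⁻ Q, ENNReal.ofReal (capacity q Q) ∂(rayleighLaw N)).toReal :=
  integral_eq_lintegral_of_nonneg_ae (ae_of_all _ (capacity_nonneg hq))
    (measurable_capacity q).aestronglyMeasurable

theorem ergodicCapacity_comp_perm {q : ℝ} (hq : 0 ≤ q) (σ : Equiv.Perm (Fin (K + 1))) :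
    ergodicCapacity (N ∘ σ) q = ergodicCapacity N q := by
  have hisometry (k : Fin (K + 1)) : ∃ E : Matrix (Fin (∑ k, N k)) (Fin (N k)) ℂ, Eᴴ * E = 1 :=
    exists_conjTranspose_mul_self_eq_one
      (Finset.single_le_sum (fun _ _ => Nat.zero_le _) (Finset.mem_univ k))
  choose E hE using hisometry
  rw [ergodicCapacity_eq_toReal_lintegral hq, ergodicCapacity_eq_toReal_lintegral hq,
    lintegral_capacity (N := N ∘ σ) (E := fun k => E (σ k)) (fun k => hE (σ k)),
    lintegral_capacity hE]
  congr 1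
  exact productAverage_perm ((isBiunitarilyInvariant_logDet q).comp ENNReal.ofReal)
    (measurable_logDet q).ennreal_ofReal (σ.ofFn_comp_perm fun k => E k * (E k)ᴴ)

end Embedding

end RayleighProduct

theorem mainTheorem5 {K : ℕ} (N : Fin (K + 1) → ℕ) (q : ℝ) (hq : 0 ≤ q)
    (σ : Equiv.Perm (Fin (K + 1))) :
    MeasureTheory.Integrable (fun Q : RayleighProduct.Channels N => RayleighProduct.capacity q Q)
      (RayleighProduct.rayleighLaw N) ∧
    MeasureTheory.Integrable
      (fun Q : RayleighProduct.Channels (N ∘ σ) => RayleighProduct.capacity q Q)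
      (RayleighProduct.rayleighLaw (N ∘ σ)) ∧
    RayleighProduct.ergodicCapacity (N ∘ σ) q = RayleighProduct.ergodicCapacity N q :=
  ⟨RayleighProduct.integrable_capacity hq, RayleighProduct.integrable_capacity hq,
    RayleighProduct.ergodicCapacity_comp_perm hq σ⟩
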